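/- Let $F$ be a field of characteristic $0$, let $H$ be a finite-dimensional unital associative $F$-algebra, and let $L$ be a finite-dimensional semisimple Lie algebra over $F$ with a generalized action of $H$, i.e. a homomorphism of unital algebras $\rho\colon H\to \mathrm{End}_F(L)$, written $hl=\rho(h)(l)$, such that for every $h\in H$ there are $h_1',h_1'',\dots,h_k',h_k''\in H$ with $h[l_1,l_2]=\sum_{i=1}^k[h_i'l_1,h_i''l_2]$ for all $l_1,l_2\in L$. Suppose that $L$ is $H$-simple, i.e. $L$ is non-abelian and its only $H$-invariant ideals are $0$ and $L$. Suppose moreover that $F$ is algebraically closed or, more generally, that the only $F$-linear maps $L\to L$ commuting with all $\mathrm{ad}\,l$ ($l\in L$) and all $\rho(h)$ ($h\in H$) are the scalars. Let $L(X\mid H)$ be the free Lie algebra over $F$ on the symbols $x_i^{\gamma}$, where $i\ge 1$ and $\gamma$ runs over a basis of $H$; for $h=\sum_\gamma a_\gamma\gamma\in H$ put $x_i^h=\sum_\gamma a_\gamma x_i^\gamma$. Let $\mathrm{Id}^H(L)$ be the ideal of all $f\in L(X\mid H)$ that vanish under every substitution $x_i^h\mapsto h\,l_i$ with $l_1,l_2,\ldots\in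 L$. Let $V_n^H$ be the span of the left-normed commutators $[x_{\sigma(1)}^{h_1},\dots,x_{\sigma(n)}^{h_n}]$ with $\sigma\in S_n$ and $h_1,\dots,h_n\in H$, and let $c_n^H(L)$ be the dimension of the image of $V_n^H$ in $L(X\mid H)/\mathrm{Id}^H(L)$. Then $c_n^H(L)\le(\dim_F L)^{n+1}$ for all $n$, and the $H$-exponent $\exp^H(L)=\lim_{n\to\infty}\sqrt[n]{c_n^H(L)}$ exists and equals $\dim_F L$. -/

import Mathlib

open Filter Topology

noncomputable section

namespace HLie

variable {F H L : Type*} [Field F] [Ring H] [Algebra F H] [LieRing L] [LieAlgebra F L]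

/-- A generalized action of the unital associative algebra `H` on the Lie algebra `L`: a
homomorphism `ρ : H → End_F(L)` such that for every `h` there are finitely many `h'ᵢ, h''ᵢ ∈ H`
with `h [l₁, l₂] = ∑ᵢ [h'ᵢ l₁, h''ᵢ l₂]` for all `l₁, l₂ ∈ L`. -/
def IsGeneralizedAction (ρ : H →ₐ[F] Module.End F L) : Prop :=
  ∀ h : H, ∃ (k : ℕ) (h' h'' : Fin k → H), ∀ l₁ l₂ : L,
    ρ h ⁅l₁, l₂⁆ = ∑ i, ⁅ρ (h' i) l₁, ρ (h'' i) l₂⁆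

/-- `L` is `H`-simple: it is non-abelian and its only `H`-invariant ideals are `0` and `L`. -/
def IsHSimple (ρ : H →ₐ[F] Module.End F L) : Prop :=
  ¬ IsLieAbelian L ∧
    ∀ I : LieIdeal F L, (∀ (h : H), ∀ x ∈ I, ρ h x ∈ I) → I = ⊥ ∨ I = ⊤

/-- `L` is central with respect to the `H`-action: the only `F`-linear maps `L → L` that commute
with `ad L` and with the action of `H` are the scalars. -/
def IsHCentral (ρ : H →ₐ[F] Module.End F L) : Prop :=
  ∀ φ : Module.End F L, (∀ x y : L, φ ⁅x, y⁆ = ⁅x, φ y⁆) →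
    (∀ (h : H) (x : L), φ (ρ h x) = ρ h (φ x)) → ∃ c : F, ∀ x : L, φ x = c • x

variable (F H) in
/-- A basis `(γ_β)` of `H`. -/
def basisH : Module.Basis (Module.Free.ChooseBasisIndex F H) F H :=
  Module.Free.chooseBasis F H

variable (F H) in
/-- The algebra `L(X | H)` of Lie `H`-polynomials in the variables `X = {x₀, x₁, …}`: the free Lie
algebra on the formal generators `x_i^{γ_β}`, where `(γ_β)` is a basis of `H`. -/
abbrev FreeHLie : Type _ := FreeLieAlgebra F (ℕ × Module.Free.ChooseBasisIndex F H)

variable (F) in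
/-- The element `x_i^h` of `L(X | H)`, for arbitrary `h ∈ H`; it is linear in `h`. -/
def var (i : ℕ) (h : H) : FreeHLie F H :=
  ((basisH F H).repr h).sum fun β a => a • FreeLieAlgebra.of F (i, β)

/-- The evaluation `L(X | H) → L` at `l₀, l₁, … ∈ L`: the homomorphism of Lie algebras with
`x_i^h ↦ h l_i`. -/
def eval (ρ : H →ₐ[F] Module.End F L) (l : ℕ → L) : FreeHLie F H →ₗ⁅F⁆ L :=
  FreeLieAlgebra.lift F fun p => ρ (basisH F H p.2) (l p.1)

theorem eval_var (ρ : H →ₐ[F] Module.End F L) (l : ℕ → L) (i : ℕ) (h : H) :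
    eval ρ l (var F i h) = ρ h (l i) := by
  have h1 : eval ρ l (var F i h) =
      ((basisH F H).repr h).sum fun β a => a • ρ (basisH F H β) (l i) := by
    simp only [var, Finsupp.sum]
    rw [← LieHom.coe_toLinearMap, map_sum]
    refine Finset.sum_congr rfl fun β _ => ?_
    simp [eval]
  rw [h1]
  conv_rhs => rw [← (basisH F H).linearCombination_repr h]
  simp [Finsupp.linearCombination_apply, Finsupp.sum, LinearMap.sum_apply]

/-- The ideal `Id^H(L)` of polynomial `H`-identities of `L`: the `H`-polynomials that vanish under
every evaluation in `L`. -/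
def identities (ρ : H →ₐ[F] Module.End F L) : LieIdeal F (FreeHLie F H) :=
  ⨅ l : ℕ → L, (eval ρ l).ker

/-- The left-normed commutator `[a₁, …, aₙ] = [[a₁, …, aₙ₋₁], aₙ]`. -/
def leftNormed {A : Type*} [LieRing A] : List A → A
  | [] => 0
  | a :: as => as.foldl (fun u v => ⁅u, v⁆) a

variable (F H) in
/-- The space `V_n^H` of multilinear `H`-polynomials in `n` variables, spanned by
the commutators `[x_{σ(1)}^{h₁}, …, x_{σ(n)}^{hₙ}]` with `σ ∈ S_n` and `hᵢ ∈ H`. -/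
def multilinear (n : ℕ) : Submodule F (FreeHLie F H) :=
  Submodule.span F (Set.range fun p : Equiv.Perm (Fin n) × (Fin n → H) =>
    leftNormed (List.ofFn fun j : Fin n => var F (p.1 j : ℕ) (p.2 j)))

/-- The `H`-codimension `c_n^H(L)`: the dimension of the space of multilinear elements in `n` free
generators of the relatively free algebra `L(X | H) / Id^H(L)`. -/
def codim (ρ : H →ₐ[F] Module.End F L) (n : ℕ) : ℕ :=
  Module.finrank F ((multilinear F H n).map (identities ρ).toSubmodule.mkQ)

/-- The `H`-exponent of `L` exists and equals `d`: `lim (c_n^H(L))^{1/n} = d`. -/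
def HasHExponent (ρ : H →ₐ[F] Module.End F L) (d : ℝ) : Prop :=
  Tendsto (fun n : ℕ => (codim ρ n : ℝ) ^ (1 / (n : ℝ))) atTop (𝓝 d)

end HLie

end

/-!
A multilinear `H`-polynomial modulo identities is the multilinear map `L^n → L` that it defines,
hence the upper bound.

For the lower bound, let `d = dim L`. By `H`-simplicity, centrality and the density theorem, the
operators `ad x` and `ρ h` generate `End L`. Inserting suitable products of such operators in a
commutator of length `d` and alternating gives a nonzero alternating map, which has the form
`det (x₁, …, x_d) • g` with a constant `g ≠ 0`. A trace `tr (ad u ∘ ad v)` is inserted as a factor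
by substituting `[u, [v, xᵢ]]` for each `xᵢ` in turn, since
`∑ᵢ det (…, φ xᵢ, …) = tr φ * det (…, xᵢ, …)`. The Gram determinant of the nondegenerate Killing
form on two families of vectors is a nonzero multiple of the product of their determinants. Hence
`g` times any even number of determinants in disjoint variables is a value of an `H`-polynomial
with a fixed number of further variables, in which constants have been substituted.

Now substitute basis vectors for the variables according to a sequence of words in `d` letters,
each of which contains every letter equally often and the first `d` of which are fixed. Given such
a sequence `w`, the variables can be distributed over the determinants so that their product is `1`
at `w` and `0` at all other sequences: each determinant takes the letters `0, …, d - 1` of `w` from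
`d` consecutive words. So the codimension is at least the number of sequences, and for every
`a < d` there are, for words of suitable length, at least `a ^ n` sequences of total length `n`, up
to a constant factor.
-/

noncomputable section

namespace HLie

variable {F H : Type*} [Field F] [Ring H] [Algebra F H]
  {L L' : Type*} [LieRing L] [LieAlgebra F L] [LieRing L'] [LieAlgebra F L'] {Ω Ω' : Type*}

/-! ### Lie algebras of functions -/

instance piLieRing {A : Ω → Type*} [∀ ω, LieRing (A ω)] : LieRing (∀ ω, A ω) where
  bracket f g ω := ⁅f ω, g ω⁆
  add_lie _ _ _ := funext fun _ => add_lie _ _ _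
  lie_add _ _ _ := funext fun _ => lie_add _ _ _
  lie_self _ := funext fun _ => lie_self _
  leibniz_lie _ _ _ := funext fun _ => leibniz_lie _ _ _

@[simp]
theorem pi_lie_apply {A : Ω → Type*} [∀ ω, LieRing (A ω)] (f g : ∀ ω, A ω) (ω : Ω) :
    ⁅f, g⁆ ω = ⁅f ω, g ω⁆ := rfl

instance piLieAlgebra {A : Ω → Type*} [∀ ω, LieRing (A ω)] [∀ ω, LieAlgebra F (A ω)] :
    LieAlgebra F (∀ ω, A ω) where
  lie_smul _ _ _ := funext fun _ => lie_smul _ _ _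

variable (F L) in
/-- Evaluation at a point, as a homomorphism of Lie algebras. -/
def piEval (ω : Ω) : (Ω → L) →ₗ⁅F⁆ L :=
  { LinearMap.proj ω with map_lie' := rfl }

variable (F L) in
/-- Precomposition with a map `Ω' → Ω`, as a homomorphism of Lie algebras. -/
def piComp (φ : Ω' → Ω) : (Ω → L) →ₗ⁅F⁆ (Ω' → L) :=
  { LinearMap.funLeft F L φ with map_lie' := rfl }

/-- The pointwise action of `H` on the Lie algebra of functions `Ω → L`. -/
def piAction (ρ : H →ₐ[F] Module.End F L) (Ω : Type*) : H →ₐ[F] Module.End F (Ω → L) :=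
  AlgHom.ofLinearMap
    { toFun h := (ρ h).compLeft Ω
      map_add' _ _ := by ext; simp
      map_smul' _ _ := by ext; simp }
    (by ext; simp) (fun _ _ => by ext; simp)

@[simp]
theorem piAction_apply (ρ : H →ₐ[F] Module.End F L) (h : H) (f : Ω → L) (ω : Ω) :
    piAction ρ Ω h f ω = ρ h (f ω) := rfl

theorem IsGeneralizedAction.pi {ρ : H →ₐ[F] Module.End F L} (hρ : IsGeneralizedAction ρ)
    (Ω : Type*) : IsGeneralizedAction (piAction ρ Ω) := by
  intro h
  obtain ⟨k, h', h'', hh⟩ := hρ h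
  exact ⟨k, h', h'', fun f g => funext fun ω => by simp [hh]⟩

/-! ### Left-normed commutators -/

section leftNormed

variable {A B : Type*} [LieRing A] [LieRing B]

theorem leftNormed_concat {l : List A} (hl : l ≠ []) (a : A) :
    leftNormed (l ++ [a]) = ⁅leftNormed l, a⁆ := by
  cases l with
  | nil => contradiction
  | cons b l => simp [leftNormed]

theorem leftNormed_ofFn_succ {n : ℕ} (v : Fin (n + 2) → A) :
    leftNormed (List.ofFn v) =
      ⁅leftNormed (List.ofFn fun i : Fin (n + 1) => v i.castSucc), v (Fin.last _)⁆ := by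
  rw [List.ofFn_succ', List.concat_eq_append, leftNormed_concat (by simp)]

theorem map_leftNormed [LieAlgebra F A] [LieAlgebra F B] (φ : A →ₗ⁅F⁆ B) (l : List A) :
    φ (leftNormed l) = leftNormed (l.map φ) := by
  induction l using List.reverseRecOn with
  | nil => simp [leftNormed]
  | append_singleton l a ih =>
    rcases eq_or_ne l [] with rfl | hl
    · simp [leftNormed]
    · rw [leftNormed_concat hl, LieHom.map_lie, ih, List.map_append, List.map_singleton,
        leftNormed_concat (by simpa using hl)]

theorem exists_lie_ne_zero_of_center_eq_bot [LieAlgebra F A] (hA : LieAlgebra.center F A = ⊥)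
    {z : A} (hz : z ≠ 0) : ∃ w : A, ⁅z, w⁆ ≠ 0 := by
  contrapose! hz
  have : z ∈ LieAlgebra.center F A :=
    (LieModule.mem_maxTrivSubmodule F A A z).2 fun w => by rw [← lie_skew, hz, neg_zero]
  rwa [hA, LieSubmodule.mem_bot] at this

theorem exists_leftNormed_ne_zero [LieAlgebra F A] [Nontrivial A]
    (hA : LieAlgebra.center F A = ⊥) (n : ℕ) :
    ∃ v : Fin (n + 1) → A, leftNormed (List.ofFn v) ≠ 0 := by
  induction n with
  | zero =>
    obtain ⟨x, hx⟩ := exists_ne (0 : A)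
    exact ⟨fun _ => x, by simpa [leftNormed] using hx⟩
  | succ n ih =>
    obtain ⟨v, hv⟩ := ih
    obtain ⟨w, hw⟩ := exists_lie_ne_zero_of_center_eq_bot hA hv
    exact ⟨Fin.snoc v w, by
      rw [leftNormed_ofFn_succ]
      simpa only [Fin.snoc_castSucc, Fin.snoc_last] using hw⟩

variable (F A) in
/-- The left-normed commutator of `n` elements, as a multilinear map. -/
def leftNormedMultilinear [LieAlgebra F A] : ∀ n : ℕ, MultilinearMap F (fun _ : Fin n => A) A
  | 0 => 0
  | 1 => MultilinearMap.ofSubsingleton F A A 0 LinearMap.id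
  | n + 2 => ((LieAlgebra.ad F A : A →ₗ[F] Module.End F A).compMultilinearMap
      (leftNormedMultilinear (n + 1))).uncurryRight

theorem leftNormedMultilinear_apply [LieAlgebra F A] :
    ∀ (n : ℕ) (v : Fin n → A), leftNormedMultilinear F A n v = leftNormed (List.ofFn v)
  | 0, _ => rfl
  | 1, _ => rfl
  | n + 2, v => by
    rw [leftNormed_ofFn_succ, ← leftNormedMultilinear_apply]
    rfl

end leftNormed

/-! ### Codimensions as dimensions of spaces of functions -/

theorem map_eval {ρ : H →ₐ[F] Module.End F L} {ρ' : H →ₐ[F] Module.End F L'} (φ : L →ₗ⁅F⁆ L')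
    (hφ : ∀ h x, φ (ρ h x) = ρ' h (φ x)) (l : ℕ → L) (f : FreeHLie F H) :
    φ (eval ρ l f) = eval ρ' (fun i => φ (l i)) f := by
  have : φ.comp (eval ρ l) = eval ρ' (fun i => φ (l i)) :=
    FreeLieAlgebra.hom_ext fun p => by simp [eval, hφ]
  exact LieHom.congr_fun this f

theorem eval_leftNormed_var (ρ : H →ₐ[F] Module.End F L) (l : ℕ → L) {n : ℕ} (i : Fin n → ℕ)
    (h : Fin n → H) :
    eval ρ l (leftNormed (List.ofFn fun j => var F (i j) (h j))) =
      leftNormed (List.ofFn fun j => ρ (h j) (l (i j))) := by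
  rw [map_leftNormed, List.map_ofFn]
  simp only [Function.comp_def, eval_var]

/-- The evaluation of an `H`-polynomial as a function of the sequence of its arguments. -/
def genericEval (ρ : H →ₐ[F] Module.End F L) : FreeHLie F H →ₗ⁅F⁆ ((ℕ → L) → L) :=
  eval (piAction ρ (ℕ → L)) fun i l => l i

theorem genericEval_apply (ρ : H →ₐ[F] Module.End F L) (f : FreeHLie F H) (l : ℕ → L) :
    genericEval ρ f l = eval ρ l f :=
  map_eval (ρ := piAction ρ (ℕ → L)) (ρ' := ρ) (piEval F L l) (fun _ _ => rfl)
    (fun i l => l i) f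

theorem ker_genericEval (ρ : H →ₐ[F] Module.End F L) :
    LinearMap.ker (genericEval ρ).toLinearMap = (identities ρ).toSubmodule := by
  ext f
  simp [identities, funext_iff, genericEval_apply]

/-- The elements of `V_n^H` modulo `Id^H(L)` are the functions they define on `L`. -/
def multilinearQuotientEquiv (ρ : H →ₐ[F] Module.End F L) (n : ℕ) :
    (multilinear F H n).map (identities ρ).toSubmodule.mkQ ≃ₗ[F]
      (multilinear F H n).map (genericEval ρ).toLinearMap :=
  (Submodule.equivMapOfInjective
    ((identities ρ).toSubmodule.liftQ _ (ker_genericEval ρ).ge)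
    (LinearMap.ker_eq_bot.1 (Submodule.ker_liftQ_eq_bot' _ _ (ker_genericEval ρ).symm)) _).trans
    (LinearEquiv.ofEq _ _ (by rw [← Submodule.map_comp, Submodule.liftQ_mkQ]))

theorem codim_eq_finrank_map_genericEval (ρ : H →ₐ[F] Module.End F L) (n : ℕ) :
    codim ρ n = Module.finrank F
      ((multilinear F H n).map (genericEval ρ).toLinearMap) :=
  (multilinearQuotientEquiv ρ n).finrank_eq

variable (F L) in
/-- A multilinear map in `n` variables, as a function of sequences which only depends on the first
`n` terms. -/
def multilinearToFun (n : ℕ) :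
    MultilinearMap F (fun _ : Fin n => L) L →ₗ[F] ((ℕ → L) → L) where
  toFun m l := m fun i => l i
  map_add' _ _ := rfl
  map_smul' _ _ := rfl

theorem map_genericEval_multilinear_le (ρ : H →ₐ[F] Module.End F L) (n : ℕ) :
    (multilinear F H n).map (genericEval ρ).toLinearMap ≤
      LinearMap.range (multilinearToFun F L n) := by
  rw [multilinear, Submodule.map_span, Submodule.span_le]
  rintro _ ⟨_, ⟨⟨σ, h⟩, rfl⟩, rfl⟩
  refine ⟨((leftNormedMultilinear F L n).compLinearMap fun j => ρ (h j)).domDomCongr σ, ?_⟩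
  funext l
  refine Eq.trans ?_ ((genericEval_apply ρ _ l).trans (eval_leftNormed_var ρ l _ h)).symm
  exact leftNormedMultilinear_apply n _

section FiniteDimensional

variable {V W : Type*} [AddCommGroup V] [Module F V] [AddCommGroup W] [Module F W]
  [FiniteDimensional F V] [FiniteDimensional F W]

theorem finrank_multilinearMap_le (n : ℕ) :
    Module.finrank F (MultilinearMap F (fun _ : Fin n => V) W) ≤
      Module.finrank F V ^ n * Module.finrank F W := by
  let b := Module.finBasis F V
  let restrict : MultilinearMap F (fun _ : Fin n => V) W →ₗ[F]
      ((Fin n → Fin (Module.finrank F V)) → W) :=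
    { toFun m v := m fun i => b (v i)
      map_add' _ _ := rfl
      map_smul' _ _ := rfl }
  have restrict_injective : Function.Injective restrict := fun m m' h =>
    Module.Basis.ext_multilinear (fun _ => b) fun v => congrFun h v
  refine (LinearMap.finrank_le_finrank_of_injective restrict_injective).trans_eq ?_
  simp [Module.finrank_pi_fintype]

end FiniteDimensional

theorem codim_le [FiniteDimensional F L] (ρ : H →ₐ[F] Module.End F L) (n : ℕ) :
    codim ρ n ≤ Module.finrank F L ^ (n + 1) :=
  calc codim ρ n
      ≤ Module.finrank F (LinearMap.range (multilinearToFun F L n)) :=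
        (codim_eq_finrank_map_genericEval ρ n).trans_le
          (Submodule.finrank_mono (map_genericEval_multilinear_le ρ n))
    _ ≤ Module.finrank F (MultilinearMap F (fun _ : Fin n => L) L) :=
        LinearMap.finrank_range_le _
    _ ≤ Module.finrank F L ^ (n + 1) := (finrank_multilinearMap_le n).trans_eq (pow_succ _ _).symm

theorem eval_piAction (ρ : H →ₐ[F] Module.End F L) (a : ℕ → Ω → L) (f : FreeHLie F H) :
    eval (piAction ρ Ω) a f = genericEval ρ f ∘ fun ω i => a i ω :=
  (map_eval (ρ := piAction ρ (ℕ → L)) (ρ' := piAction ρ Ω) (piComp F L fun ω i => a i ω)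
    (fun _ _ => rfl) (fun i l => l i) f).symm

theorem finrank_map_eval_piAction_le_codim [FiniteDimensional F L] (ρ : H →ₐ[F] Module.End F L)
    (a : ℕ → Ω → L) (n : ℕ) :
    Module.finrank F ((multilinear F H n).map (eval (piAction ρ Ω) a).toLinearMap) ≤
      codim ρ n := by
  have eval_eq_comp : (eval (piAction ρ Ω) a).toLinearMap =
      LinearMap.funLeft F L (fun ω i => a i ω) ∘ₗ (genericEval ρ).toLinearMap :=
    LinearMap.ext (eval_piAction ρ a)
  have := Submodule.finiteDimensional_of_le (map_genericEval_multilinear_le ρ n)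
  rw [eval_eq_comp, Submodule.map_comp, codim_eq_finrank_map_genericEval]
  exact Submodule.finrank_map_le _ _

/-! ### Values of multilinear polynomials -/

/-- The span of the values of the left-normed commutators `[x_{σ(1)}^{h₁}, …, x_{σ(n)}^{hₙ}]`, with
`hᵢ ∈ H` and `σ ∈ S_n`, under the substitution of the `n` members of the multiset `s` for the
variables. -/
def multilinearValues (ρ : H →ₐ[F] Module.End F L) (s : Multiset L) : Submodule F L :=
  Submodule.span F {x | ∃ (n : ℕ) (h : Fin n → H) (a : Fin n → L),
    ∑ i, {a i} = s ∧ leftNormed (List.ofFn fun i => ρ (h i) (a i)) = x}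

section multilinearValues

variable {ρ : H →ₐ[F] Module.End F L} {s t : Multiset L} {x y m : L}

theorem act_mem_multilinearValues (h : H) (a : L) : ρ h a ∈ multilinearValues ρ {a} :=
  Submodule.subset_span ⟨1, fun _ => h, fun _ => a, by simp, by simp [leftNormed]⟩

theorem mem_multilinearValues_singleton (a : L) : a ∈ multilinearValues ρ {a} := by
  simpa using act_mem_multilinearValues (ρ := ρ) 1 a

theorem lie_act_mem_multilinearValues (hx : x ∈ multilinearValues ρ s) (h : H) (a : L) :
    ⁅x, ρ h a⁆ ∈ multilinearValues ρ (s + {a}) := by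
  induction hx using Submodule.span_induction with
  | mem x hx =>
    obtain ⟨n, h', a', rfl, rfl⟩ := hx
    cases n with
    | zero => simp [leftNormed]
    | succ n =>
      refine Submodule.subset_span
        ⟨n + 2, Fin.snoc (α := fun _ => H) h' h, Fin.snoc (α := fun _ => L) a' a, ?_, ?_⟩
      · simp only [Fin.sum_univ_castSucc (n := n + 1), Fin.snoc_castSucc, Fin.snoc_last]
      · simp only [leftNormed_ofFn_succ, Fin.snoc_castSucc, Fin.snoc_last]
  | zero => simp
  | add x y _ _ hx hy => simpa only [add_lie] using add_mem hx hy
  | smul c x _ hx => simpa only [smul_lie] using Submodule.smul_mem _ c hx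

theorem multilinearValues_induction {p : Multiset L → L → Prop}
    (act : ∀ h a, p {a} (ρ h a))
    (lie_act : ∀ s x h a, x ∈ multilinearValues ρ s → p s x → p (s + {a}) ⁅x, ρ h a⁆)
    (zero : ∀ s, p s 0) (add : ∀ s x y, p s x → p s y → p s (x + y))
    (smul : ∀ s (c : F) x, p s x → p s (c • x)) (hx : x ∈ multilinearValues ρ s) : p s x := by
  induction hx using Submodule.span_induction with
  | mem x hx =>
    obtain ⟨n, h, a, rfl, rfl⟩ := hx
    induction n with
    | zero => exact zero _
    | succ n ih =>
      cases n with
      | zero => simpa [leftNormed] using act (h 0) (a 0)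
      | succ n =>
        rw [Fin.sum_univ_castSucc, leftNormed_ofFn_succ]
        exact lie_act _ _ _ _ (Submodule.subset_span ⟨_, _, _, rfl, rfl⟩) (ih _ _)
  | zero => exact zero s
  | add x y _ _ hx hy => exact add s x y hx hy
  | smul c x _ hx => exact smul s c x hx

theorem lie_mem_multilinearValues (hx : x ∈ multilinearValues ρ s)
    (hy : y ∈ multilinearValues ρ t) : ⁅x, y⁆ ∈ multilinearValues ρ (s + t) := by
  revert s x
  refine multilinearValues_induction
    (p := fun t y => ∀ {s x}, x ∈ multilinearValues ρ s → ⁅x, y⁆ ∈ multilinearValues ρ (s + t))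
    ?_ ?_ ?_ ?_ ?_ hy
  · exact fun h a s x hx => lie_act_mem_multilinearValues hx h a
  · intro t y h a _ ih s x hx
    rw [leibniz_lie, ← lie_skew y ⁅x, ρ h a⁆]
    refine add_mem ?_ (neg_mem ?_)
    · rw [← add_assoc]
      exact lie_act_mem_multilinearValues (ih hx) h a
    · rw [← add_assoc, add_right_comm]
      exact ih (lie_act_mem_multilinearValues hx h a)
  · intro t s x _
    simp
  · intro t y z hy hz s x hx
    simpa only [lie_add] using add_mem (hy hx) (hz hx)
  · intro t c y hy s x hx
    simpa only [lie_smul] using Submodule.smul_mem _ c (hy hx)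

theorem map_act_mem_multilinearValues (hρ : IsGeneralizedAction ρ)
    (hx : x ∈ multilinearValues ρ s) (h : H) : ρ h x ∈ multilinearValues ρ s := by
  revert h
  refine multilinearValues_induction (p := fun s x => ∀ h, ρ h x ∈ multilinearValues ρ s)
    ?_ ?_ ?_ ?_ ?_ hx
  · intro h a h'
    simpa using act_mem_multilinearValues (ρ := ρ) (h' * h) a
  · intro s x h a _ ih h'
    obtain ⟨k, h₁, h₂, hh⟩ := hρ h'
    rw [hh]
    refine sum_mem fun i _ => ?_
    simpa using lie_act_mem_multilinearValues (ih (h₁ i)) (h₂ i * h) a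
  · intro s h
    simp
  · intro s x y hx hy h
    simpa only [map_add] using add_mem (hx h) (hy h)
  · intro s c x hx h
    simpa only [map_smul] using Submodule.smul_mem _ c (hx h)

theorem multilinearValues_subst (hρ : IsGeneralizedAction ρ)
    (hx : x ∈ multilinearValues ρ ({m} + s)) (hm : m ∈ multilinearValues ρ t) :
    x ∈ multilinearValues ρ (t + s) := by
  refine multilinearValues_induction
    (p := fun u x => ∀ s, u = {m} + s → x ∈ multilinearValues ρ (t + s))
    ?_ ?_ ?_ ?_ ?_ hx s rfl
  · intro h a s has
    obtain ⟨rfl, rfl⟩ : m = a ∧ s = 0 := by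
      rw [Multiset.singleton_add] at has
      exact ((Multiset.singleton_eq_cons_iff _).1 has).imp_left Eq.symm
    simpa using map_act_mem_multilinearValues hρ hm h
  · intro u x h a hx ih s hus
    rcases eq_or_ne m a with rfl | hma
    · obtain rfl : u = s := by rwa [add_comm, add_right_inj] at hus
      rw [add_comm]
      exact lie_mem_multilinearValues hx (map_act_mem_multilinearValues hρ hm h)
    · obtain ⟨r, rfl⟩ : ∃ r, u = {m} + r := by
        refine Multiset.exists_cons_of_mem ?_
        have : m ∈ u + {a} := hus ▸ by simp
        simpa [hma] using this
      obtain rfl : s = r + {a} := by rwa [add_assoc, add_right_inj, eq_comm] at hus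
      rw [← add_assoc]
      exact lie_act_mem_multilinearValues (ih r rfl) h a
  · exact fun _ _ _ => zero_mem _
  · exact fun u x y hx hy s hs => add_mem (hx s hs) (hy s hs)
  · exact fun u c x hx s hs => Submodule.smul_mem _ c (hx s hs)

theorem map_mem_multilinearValues {ρ' : H →ₐ[F] Module.End F L'} (φ : L →ₗ⁅F⁆ L')
    (hφ : ∀ h x, φ (ρ h x) = ρ' h (φ x)) (hx : x ∈ multilinearValues ρ s) :
    φ x ∈ multilinearValues ρ' (s.map φ) := by
  refine multilinearValues_induction (p := fun s x => φ x ∈ multilinearValues ρ' (s.map φ))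
    ?_ ?_ ?_ ?_ ?_ hx
  · intro h a
    simpa [hφ] using act_mem_multilinearValues h (φ a)
  · intro s x h a _ hx
    simpa [hφ] using lie_act_mem_multilinearValues hx h (φ a)
  · simp
  · intro s x y hx hy
    simpa using add_mem hx hy
  · intro s c x hx
    simpa using Submodule.smul_mem _ c hx

theorem leftNormed_mem_multilinearValues {n : ℕ} {s : Fin n → Multiset L} {x : Fin n → L}
    (hx : ∀ i, x i ∈ multilinearValues ρ (s i)) :
    leftNormed (List.ofFn x) ∈ multilinearValues ρ (∑ i, s i) := by
  induction n with
  | zero => exact zero_mem _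
  | succ n ih =>
    cases n with
    | zero => simpa [leftNormed] using hx 0
    | succ n =>
      rw [Fin.sum_univ_castSucc, leftNormed_ofFn_succ]
      exact lie_mem_multilinearValues (ih fun i => hx i.castSucc) (hx _)

end multilinearValues

theorem exists_equiv_of_sum_singleton_eq {ι κ α : Type*} [Fintype ι] [Fintype κ] {f : ι → α}
    {g : κ → α} (h : ∑ i, ({f i} : Multiset α) = ∑ j, {g j}) :
    ∃ e : ι ≃ κ, ∀ i, g (e i) = f i := by
  classical
  have card_fiber_eq (a : α) : Fintype.card {i // f i = a} = Fintype.card {j // g j = a} := by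
    simpa [Multiset.count_sum', Multiset.count_singleton, Fintype.card_subtype, eq_comm]
      using congrArg (Multiset.count a) h
  exact ⟨Equiv.ofFiberEquiv fun a => Fintype.equivOfCardEq (card_fiber_eq a),
    Equiv.ofFiberEquiv_map _⟩

theorem exists_sum_singleton_eq {α : Type*} [Nonempty α] (s : Multiset α) :
    ∃ a : ℕ → α, ∑ i : Fin s.card, {a i} = s := by
  induction s using Multiset.induction_on with
  | empty => exact ⟨Classical.arbitrary _, by simp⟩
  | cons x s ih =>
    obtain ⟨a, ha⟩ := ih
    refine ⟨fun i => i.casesOn x a, ?_⟩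
    rw [Multiset.card_cons, Fin.sum_univ_succ, ← Multiset.singleton_add]
    exact congrArg _ ha

theorem multilinearValues_le_map_eval (ρ : H →ₐ[F] Module.End F L) (l : ℕ → L) (n : ℕ) :
    multilinearValues ρ (∑ i : Fin n, {l i}) ≤ (multilinear F H n).map (eval ρ l).toLinearMap := by
  rw [multilinearValues, Submodule.span_le]
  rintro _ ⟨n', h, a, ha, rfl⟩
  obtain ⟨σ, hσ⟩ := exists_equiv_of_sum_singleton_eq ha
  obtain rfl : n' = n := by simpa using Fintype.card_congr σ
  refine ⟨_, Submodule.subset_span ⟨(σ, h), rfl⟩, ?_⟩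
  exact (eval_leftNormed_var ρ l _ h).trans (by simp only [hσ])

theorem finrank_multilinearValues_le_codim [FiniteDimensional F L] [Finite Ω]
    (ρ : H →ₐ[F] Module.End F L) (s : Multiset (Ω → L)) :
    Module.finrank F (multilinearValues (piAction ρ Ω) s) ≤ codim ρ s.card := by
  obtain ⟨a, ha⟩ := exists_sum_singleton_eq s
  calc Module.finrank F (multilinearValues (piAction ρ Ω) s)
      ≤ Module.finrank F ((multilinear F H s.card).map (eval (piAction ρ Ω) a).toLinearMap) := by
        conv_lhs => rw [← ha]
        exact Submodule.finrank_mono (multilinearValues_le_map_eval _ a _)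
    _ ≤ codim ρ s.card := finrank_map_eval_piAction_le_codim ρ a _

/-! ### Density -/

theorem subalgebra_eq_top_of_algebraMap_surjective {V : Type*} [AddCommGroup V] [Module F V]
    [FiniteDimensional F V] (A : Subalgebra F (Module.End F V)) [IsSemisimpleModule A V]
    (hA : Function.Surjective (algebraMap F (Module.End A V))) : A = ⊤ := by
  classical
  refine eq_top_iff.2 fun T _ => ?_
  let T' : Module.End (Module.End A V) V :=
    { toFun := T
      map_add' := map_add T
      map_smul' φ x := by
        obtain ⟨c, rfl⟩ := hA φ
        simp }
  let b := Module.finBasis F V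
  obtain ⟨r, hr⟩ := jacobson_density T' (Finset.univ.image b)
  obtain rfl : T = r := b.ext fun i => hr (b i) (by simp)
  exact r.2

section multiplicationAlgebra

variable {ρ : H →ₐ[F] Module.End F L}

/-- The operators `ad x` and `ρ h`. -/
def multiplications (ρ : H →ₐ[F] Module.End F L) : Set (Module.End F L) :=
  Set.range (LieAlgebra.ad F L) ∪ Set.range ρ

/-- The algebra generated by the operators `ad x` and `ρ h`; its submodules of `L` are the
`H`-invariant ideals. -/
def multiplicationAlgebra (ρ : H →ₐ[F] Module.End F L) : Subalgebra F (Module.End F L) :=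
  Algebra.adjoin F (multiplications ρ)

theorem ad_mem_multiplicationAlgebra (x : L) : LieAlgebra.ad F L x ∈ multiplicationAlgebra ρ :=
  Algebra.subset_adjoin (Or.inl ⟨x, rfl⟩)

theorem act_mem_multiplicationAlgebra (h : H) : ρ h ∈ multiplicationAlgebra ρ :=
  Algebra.subset_adjoin (Or.inr ⟨h, rfl⟩)

theorem nontrivial_of_not_isLieAbelian (h : ¬ IsLieAbelian L) : Nontrivial L := by
  contrapose! h
  exact ⟨fun _ _ => Subsingleton.elim _ _⟩

/-- The invariant ideal underlying a submodule over the multiplication algebra. -/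
def idealOfSubmodule (N : Submodule (multiplicationAlgebra ρ) L) : LieIdeal F L :=
  { N.restrictScalars F with
    lie_mem := fun {x _} hm => N.smul_mem ⟨_, ad_mem_multiplicationAlgebra x⟩ hm }

theorem IsHSimple.isSimpleModule (hs : IsHSimple ρ) :
    IsSimpleModule (multiplicationAlgebra ρ) L := by
  have := nontrivial_of_not_isLieAbelian hs.1
  refine (isSimpleModule_iff _ _).2 { eq_bot_or_eq_top := fun N => ?_ }
  have coe_eq_coe {I : LieIdeal F L} (h : idealOfSubmodule N = I) : (N : Set L) = I :=
    congrArg ((↑) : LieIdeal F L → Set L) h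
  exact (hs.2 (idealOfSubmodule N) fun h x hx =>
    N.smul_mem ⟨_, act_mem_multiplicationAlgebra h⟩ hx).imp
      (fun h => SetLike.coe_injective (coe_eq_coe h))
      (fun h => SetLike.coe_injective (coe_eq_coe h))

theorem isHCentral_iff_algebraMap_surjective :
    IsHCentral ρ ↔ Function.Surjective (algebraMap F (Module.End (multiplicationAlgebra ρ) L)) := by
  refine ⟨fun hc φ => ?_, fun hsurj φ hφad hφρ => ?_⟩
  · have commutes {T : Module.End F L} (hT : T ∈ multiplicationAlgebra ρ) (x : L) :
        φ (T x) = T (φ x) := φ.map_smul ⟨T, hT⟩ x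
    obtain ⟨c, hφ⟩ := hc (φ.restrictScalars F)
      (fun x => commutes (ad_mem_multiplicationAlgebra x))
      (fun h => commutes (act_mem_multiplicationAlgebra h))
    exact ⟨c, LinearMap.ext fun x => (hφ x).symm⟩
  · have commutes : multiplicationAlgebra ρ ≤ Subalgebra.centralizer F {φ} := by
      refine Algebra.adjoin_le ?_
      rintro _ (⟨x, rfl⟩ | ⟨h, rfl⟩) _ rfl
      · exact LinearMap.ext (hφad x)
      · exact LinearMap.ext (hφρ h)
    let φ' : Module.End (multiplicationAlgebra ρ) L :=
      { φ with map_smul' := fun T x => LinearMap.congr_fun (commutes T.2 φ rfl) x }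
    obtain ⟨c, hφ'⟩ := hsurj φ'
    exact ⟨c, fun x => (LinearMap.congr_fun hφ' x).symm⟩

theorem IsHSimple.isHCentral [IsAlgClosed F] [FiniteDimensional F L] (hs : IsHSimple ρ) :
    IsHCentral ρ := by
  have := hs.isSimpleModule
  exact isHCentral_iff_algebraMap_surjective.2
    (IsSimpleModule.algebraMap_end_bijective_of_isAlgClosed F).2

theorem span_closure_multiplications_eq_top [FiniteDimensional F L] (hs : IsHSimple ρ)
    (hc : IsHCentral ρ) :
    Submodule.span F (Submonoid.closure (multiplications ρ) : Set (Module.End F L)) = ⊤ := by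
  have := hs.isSimpleModule
  have : multiplicationAlgebra ρ = ⊤ := subalgebra_eq_top_of_algebraMap_surjective _
    (isHCentral_iff_algebraMap_surjective.1 hc)
  rw [← Algebra.adjoin_eq_span, ← multiplicationAlgebra, this, Algebra.top_toSubmodule]

end multiplicationAlgebra

/-! ### Multilinear maps and determinants -/

theorem exists_multilinearMap_ne_zero_of_span_eq_top {ι V W : Type*} [Finite ι]
    [AddCommGroup V] [Module F V] [AddCommGroup W] [Module F W] {S : Set V}
    (hS : Submodule.span F S = ⊤) {m : MultilinearMap F (fun _ : ι => V) W} (hm : m ≠ 0) :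
    ∃ v : ι → V, (∀ i, v i ∈ S) ∧ m v ≠ 0 := by
  contrapose! hm
  exact Module.Basis.ext_multilinear (fun _ => Module.Basis.ofSpan hS.ge) fun v =>
    hm _ fun i => Module.Basis.ofSpan_subset hS.ge ⟨v i, rfl⟩

section LinearAlgebra

variable {ι V U W : Type*} [Fintype ι] [DecidableEq ι] [AddCommGroup V] [Module F V]
  [AddCommGroup U] [Module F U] [AddCommGroup W] [Module F W] (b : Module.Basis ι F V)

theorem alternatization_compLinearMap_smulRight (m : MultilinearMap F (fun _ : ι => U) W)
    (w : ι → U) :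
    MultilinearMap.alternatization (m.compLinearMap fun i => (b.coord i).smulRight (w i)) b =
      m w := by
  rw [MultilinearMap.alternatization_apply, Finset.sum_eq_single 1]
  · simp
  · intro σ _ hσ
    obtain ⟨i, hi⟩ : ∃ i, σ i ≠ i := by
      by_contra! h
      exact hσ (Equiv.ext h)
    have : m (fun i => (b.coord i).smulRight (w i) (b (σ i))) = 0 :=
      m.map_coord_zero i (by simp [hi])
    exact (congrArg (Equiv.Perm.sign σ • ·) this).trans (smul_zero _)
  · simp

theorem exists_alternatization_compLinearMap_ne_zero {S : Set (V →ₗ[F] U)}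
    (hS : Submodule.span F S = ⊤) {m : MultilinearMap F (fun _ : ι => U) W} (hm : m ≠ 0) :
    ∃ A : ι → V →ₗ[F] U, (∀ i, A i ∈ S) ∧
      MultilinearMap.alternatization (m.compLinearMap A) b ≠ 0 := by
  let N : MultilinearMap F (fun _ : ι => V →ₗ[F] U) W :=
    ∑ σ : Equiv.Perm ι, Equiv.Perm.sign σ • m.compLinearMap fun i => LinearMap.applyₗ (b (σ i))
  have N_apply (A : ι → V →ₗ[F] U) :
      N A = MultilinearMap.alternatization (m.compLinearMap A) b := by
    simp [N, MultilinearMap.alternatization_apply]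
  simp only [← N_apply]
  refine exists_multilinearMap_ne_zero_of_span_eq_top hS fun hN => hm ?_
  ext w
  rw [← alternatization_compLinearMap_smulRight b, ← N_apply, hN]
  rfl

theorem alternatingMap_eq_det_smul (f : V [⋀^ι]→ₗ[F] W) (x : ι → V) : f x = b.det x • f b := by
  have : f = (LinearMap.toSpanSingleton F W (f b)).compAlternatingMap b.det := by
    refine Module.Basis.ext_alternating b fun v hv => ?_
    have : (fun i => b (v i)) = b ∘ Equiv.ofBijective v (Finite.injective_iff_bijective.1 hv) :=
      rfl
    rw [this, AlternatingMap.map_perm, AlternatingMap.map_perm]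
    simp [b.det_self]
  exact DFunLike.congr_fun this x

theorem sum_det_update_eq_trace_mul_det (φ : Module.End F V) (x : ι → V) :
    ∑ i, b.det (Function.update x i (φ (x i))) = LinearMap.trace F V φ * b.det x := by
  let X := b.toMatrix x
  let Φ := LinearMap.toMatrix b b φ
  have det_update (i : ι) :
      b.det (Function.update x i (φ (x i))) = (X.adjugate * (Φ * X)) i i := by
    have col_eq : (b.repr (φ (x i)) : ι → F) = fun j => (Φ * X) j i := by
      rw [← LinearMap.toMatrix_mulVec_repr b b φ (x i)]
      rfl
    rw [Module.Basis.det_apply, Module.Basis.toMatrix_update, col_eq, ← Matrix.cramer_apply,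
      Matrix.cramer_eq_adjugate_mulVec]
    rfl
  calc ∑ i, b.det (Function.update x i (φ (x i)))
      = Matrix.trace (X.adjugate * (Φ * X)) := Finset.sum_congr rfl fun i _ => det_update i
    _ = Matrix.trace (Φ * (X * X.adjugate)) := by rw [Matrix.trace_mul_comm, Matrix.mul_assoc]
    _ = LinearMap.trace F V φ * b.det x := by
      rw [Matrix.mul_adjugate, LinearMap.trace_eq_matrix_trace F b, Module.Basis.det_apply]
      simp [mul_comm, X, Φ]

theorem det_of_bilinear (B : V →ₗ[F] V →ₗ[F] F) (u v : ι → V) :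
    (Matrix.of fun i j => B (u i) (v j)).det =
      (LinearMap.toMatrix₂ b b B).det * (b.det u * b.det v) := by
  have : (Matrix.of fun i j => B (u i) (v j)) =
      (b.toMatrix u).transpose * LinearMap.toMatrix₂ b b B * b.toMatrix v := by
    ext i j
    rw [Matrix.of_apply, apply_eq_dotProduct_toMatrix₂_mulVec b b, Matrix.mul_assoc]
    rfl
  rw [this, Matrix.det_mul, Matrix.det_mul, Matrix.det_transpose, Module.Basis.det_apply,
    Module.Basis.det_apply]
  ring

end LinearAlgebra

/-! ### Polynomial functions -/

/-- The functions `(x_i)_{i ∈ ι} ↦ f (x, c)` on `L^ι` defined by the multilinear `H`-polynomials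
`f` whose variables are the `x_i`, `i ∈ ι`, and further ones for which the constants in the
multiset `c` have been substituted. -/
def polyFunctions (ρ : H →ₐ[F] Module.End F L) (ι : Type*) [Fintype ι] (c : Multiset L) :
    Submodule F ((ι → L) → L) :=
  multilinearValues (piAction ρ (ι → L)) (∑ i, {fun x => x i} + c.map (Function.const _))

section polyFunctions

variable {ρ : H →ₐ[F] Module.End F L} {ι κ : Type*} [Fintype ι] [Fintype κ] {c : Multiset L}
  {f : (ι → L) → L}

theorem comp_mem_multilinearValues (φ : Ω' → Ω) {s : Multiset (Ω → L)} {x : Ω → L}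
    (hx : x ∈ multilinearValues (piAction ρ Ω) s) :
    x ∘ φ ∈ multilinearValues (piAction ρ Ω') (s.map (· ∘ φ)) :=
  map_mem_multilinearValues (piComp F L φ) (fun _ _ => rfl) hx

theorem polyFunctions_apply_mem_multilinearValues (hf : f ∈ polyFunctions ρ ι c)
    (a : ι → Ω → L) :
    (fun ω => f fun i => a i ω) ∈
      multilinearValues (piAction ρ Ω) (∑ i, {a i} + c.map (Function.const Ω)) := by
  have := comp_mem_multilinearValues (fun ω i => a i ω) hf
  rwa [Multiset.map_add, ← Multiset.coe_mapAddMonoidHom, map_sum, Multiset.coe_mapAddMonoidHom,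
    Multiset.map_map] at this

theorem polyFunctions_reindex (e : ι ≃ κ) (hf : f ∈ polyFunctions ρ ι c) :
    (fun x => f (x ∘ e)) ∈ polyFunctions ρ κ c := by
  rw [polyFunctions, ← e.sum_comp]
  exact polyFunctions_apply_mem_multilinearValues hf fun i (x : κ → L) => x (e i)

theorem lie_const_mem_polyFunctions (hf : f ∈ polyFunctions ρ ι c) (w : L) :
    (fun x => ⁅f x, w⁆) ∈ polyFunctions ρ ι (c + {w}) := by
  rw [polyFunctions, Multiset.map_add, ← add_assoc, Multiset.map_singleton]
  exact lie_mem_multilinearValues hf (mem_multilinearValues_singleton (Function.const _ w))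

theorem exists_multiplication_mem_multilinearValues (hρ : IsGeneralizedAction ρ)
    {A : Module.End F L} (hA : A ∈ Submonoid.closure (multiplications ρ)) :
    ∃ c : Multiset L,
      ⇑A ∈ multilinearValues (piAction ρ L) ({id} + c.map (Function.const L)) := by
  induction hA using Submonoid.closure_induction with
  | mem A hA =>
    rcases hA with ⟨x, rfl⟩ | ⟨h, rfl⟩
    · refine ⟨{x}, ?_⟩
      rw [add_comm]
      exact lie_mem_multilinearValues (mem_multilinearValues_singleton (Function.const L x))
        (mem_multilinearValues_singleton id)
    · refine ⟨0, ?_⟩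
      simpa using! act_mem_multilinearValues (ρ := piAction ρ L) h id
  | one => exact ⟨0, by simpa using! mem_multilinearValues_singleton (id : L → L)⟩
  | mul A B _ _ hA hB =>
    obtain ⟨c, hA⟩ := hA
    obtain ⟨c', hB⟩ := hB
    refine ⟨c' + c, ?_⟩
    have hAB := comp_mem_multilinearValues B hA
    rw [Multiset.map_add, Multiset.map_singleton, Multiset.map_map] at hAB
    rw [Multiset.map_add, ← add_assoc]
    exact multilinearValues_subst (hρ.pi L) hAB hB

theorem exists_leftNormedMultilinear_compLinearMap_mem_polyFunctions (hρ : IsGeneralizedAction ρ)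
    {d : ℕ} {A : Fin d → Module.End F L} (hA : ∀ i, A i ∈ Submonoid.closure (multiplications ρ)) :
    ∃ c : Multiset L,
      ⇑((leftNormedMultilinear F L d).compLinearMap A) ∈ polyFunctions ρ (Fin d) c := by
  choose c hc using fun i => exists_multiplication_mem_multilinearValues hρ (hA i)
  have hmem := leftNormed_mem_multilinearValues fun i =>
    comp_mem_multilinearValues (fun x : Fin d → L => x i) (hc i)
  refine ⟨∑ i, c i, ?_⟩
  convert hmem using 1
  · simp only [polyFunctions, Multiset.map_add, Finset.sum_add_distrib, Multiset.map_singleton,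
      Multiset.map_map]
    rw [← Multiset.coe_mapAddMonoidHom, map_sum]
    rfl
  · funext x
    have := map_leftNormed (piEval F L x) (List.ofFn fun i => A i ∘ fun y : Fin d → L => y i)
    rw [List.map_ofFn] at this
    exact (leftNormedMultilinear_apply d _).trans this.symm

theorem alternatization_mem_polyFunctions [DecidableEq ι] {m : MultilinearMap F (fun _ : ι => L) L}
    (hm : ⇑m ∈ polyFunctions ρ ι c) :
    ⇑(MultilinearMap.alternatization m) ∈ polyFunctions ρ ι c := by
  have : ⇑(MultilinearMap.alternatization m) =
      ∑ σ : Equiv.Perm ι, Equiv.Perm.sign σ • fun x => m (x ∘ σ) := by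
    funext x
    simp [MultilinearMap.alternatization_apply, Finset.sum_apply, Function.comp_def]
  rw [this]
  refine sum_mem fun σ _ => ?_
  rw [Units.smul_def]
  exact zsmul_mem (polyFunctions_reindex σ hm) _

theorem leftNormedMultilinear_ne_zero (hL : LieAlgebra.center F L = ⊥) [Nontrivial L] {n : ℕ}
    (hn : n ≠ 0) : leftNormedMultilinear F L n ≠ 0 := by
  obtain ⟨n, rfl⟩ := Nat.exists_eq_succ_of_ne_zero hn
  obtain ⟨v, hv⟩ := exists_leftNormed_ne_zero (F := F) hL n
  exact fun h => hv (by rw [← leftNormedMultilinear_apply (F := F), h]; rfl)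

theorem exists_det_smul_mem_polyFunctions [FiniteDimensional F L] (hρ : IsGeneralizedAction ρ)
    (hs : IsHSimple ρ) (hc : IsHCentral ρ) (hL : LieAlgebra.center F L = ⊥) {d : ℕ}
    (b : Module.Basis (Fin d) F L) :
    ∃ q : ℕ, ∀ n ≥ q, ∃ c : Multiset L, c.card = n ∧ ∃ g : L, g ≠ 0 ∧
      (fun x => b.det x • g) ∈ polyFunctions ρ (Fin d) c := by
  have := nontrivial_of_not_isLieAbelian hs.1
  have hd : d ≠ 0 := fun h => by
    have := b.index_nonempty
    exact Fin.pos' (n := d) |>.ne' h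
  obtain ⟨A, hA, hne⟩ := exists_alternatization_compLinearMap_ne_zero b
    (span_closure_multiplications_eq_top hs hc) (leftNormedMultilinear_ne_zero (F := F) hL hd)
  obtain ⟨c, hmem⟩ := exists_leftNormedMultilinear_compLinearMap_mem_polyFunctions hρ hA
  refine ⟨c.card, fun n hn => ?_⟩
  induction n, hn using Nat.le_induction with
  | base =>
    refine ⟨c, rfl, _, hne, ?_⟩
    simpa only [← alternatingMap_eq_det_smul] using alternatization_mem_polyFunctions hmem
  | succ n _ ih =>
    obtain ⟨c, rfl, g, hg, h⟩ := ih
    obtain ⟨w, hw⟩ := exists_lie_ne_zero_of_center_eq_bot hL hg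
    refine ⟨c + {w}, by simp, ⁅g, w⁆, hw, ?_⟩
    simpa only [smul_lie] using lie_const_mem_polyFunctions h w

end polyFunctions

/-! ### Multiplication by determinants -/

/-- The functions `G : Ω → L` such that `det (a_i)_i • G` is a value, for all `a : ι → Ω → L`, of
a multilinear polynomial whose arguments are the `a_i` and the members of `s`. -/
def detValues (ρ : H →ₐ[F] Module.End F L) {ι : Type*} [Fintype ι] [DecidableEq ι]
    (b : Module.Basis ι F L) (s : Multiset (Ω → L)) : Submodule F (Ω → L) :=
  ⨅ a : ι → Ω → L, (multilinearValues (piAction ρ Ω) (∑ i, {a i} + s)).comap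
    (LinearMap.pi fun ω => b.det (fun i => a i ω) • LinearMap.proj ω)

section detValues

variable {ρ : H →ₐ[F] Module.End F L} {ι κ : Type*} [Fintype ι] [DecidableEq ι]
  {b : Module.Basis ι F L} {s : Multiset (Ω → L)} {G : Ω → L}

theorem mem_detValues : G ∈ detValues ρ b s ↔ ∀ a : ι → Ω → L,
    (fun ω => b.det (fun i => a i ω) • G ω) ∈
      multilinearValues (piAction ρ Ω) (∑ i, {a i} + s) := by
  rw [detValues, Submodule.mem_iInf]
  rfl

theorem det_update_smul_mem_multilinearValues (hρ : IsGeneralizedAction ρ)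
    (hG : G ∈ detValues ρ b s) {t : Multiset (Ω → L)} (a : ι → Ω → L) (i : ι) {x : Ω → L}
    (hx : x ∈ multilinearValues (piAction ρ Ω) (t + {a i})) :
    (fun ω => b.det (Function.update (fun i => a i ω) i (x ω)) • G ω) ∈
      multilinearValues (piAction ρ Ω) (∑ i, {a i} + (t + s)) := by
  have eval_update (ω : Ω) : Function.update (fun i => a i ω) i (x ω) =
      fun j => Function.update a i x j ω := by
    funext j
    rcases eq_or_ne j i with rfl | hj <;> simp [*]
  have sum_update : ∑ j, ({Function.update a i x j} : Multiset (Ω → L)) =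
      {x} + ∑ j ∈ Finset.univ.erase i, {a j} := by
    rw [← Finset.add_sum_erase _ _ (Finset.mem_univ i), Function.update_self]
    refine congrArg _ (Finset.sum_congr rfl fun j hj => ?_)
    rw [Function.update_of_ne (Finset.ne_of_mem_erase hj)]
  have hmem := mem_detValues.1 hG (Function.update a i x)
  rw [sum_update, add_assoc] at hmem
  simp only [eval_update]
  convert multilinearValues_subst (hρ.pi Ω) hmem hx using 2
  rw [← Finset.add_sum_erase _ _ (Finset.mem_univ i)]
  abel

theorem killingForm_smul_mem_detValues (hρ : IsGeneralizedAction ρ) (hG : G ∈ detValues ρ b s)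
    (u v : Ω → L) :
    (fun ω => killingForm F L (u ω) (v ω) • G ω) ∈ detValues ρ b ({u} + {v} + s) := by
  refine mem_detValues.2 fun a => ?_
  have : (fun ω => b.det (fun i => a i ω) • killingForm F L (u ω) (v ω) • G ω) =
      ∑ i, fun ω => b.det (Function.update (fun i => a i ω) i ⁅u ω, ⁅v ω, a i ω⁆⁆) • G ω := by
    funext ω
    rw [Finset.sum_apply, ← Finset.sum_smul, smul_smul, mul_comm, killingForm_apply_apply,
      ← sum_det_update_eq_trace_mul_det]
    rfl
  rw [this]
  refine sum_mem fun i _ =>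
    det_update_smul_mem_multilinearValues hρ hG a i (x := ⁅u, ⁅v, a i⁆⁆) ?_
  rw [add_assoc]
  exact lie_mem_multilinearValues (mem_multilinearValues_singleton u)
    (lie_mem_multilinearValues (mem_multilinearValues_singleton v)
      (mem_multilinearValues_singleton (a i)))

theorem prod_killingForm_smul_mem_detValues (hρ : IsGeneralizedAction ρ)
    (hG : G ∈ detValues ρ b s) (u v : κ → Ω → L) (A : Finset κ) :
    (fun ω => (∏ i ∈ A, killingForm F L (u i ω) (v i ω)) • G ω) ∈
      detValues ρ b (∑ i ∈ A, {u i} + ∑ i ∈ A, {v i} + s) := by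
  classical
  induction A using Finset.induction_on with
  | empty => simpa using hG
  | insert i A hi ih =>
    convert killingForm_smul_mem_detValues hρ ih (u i) (v i) using 2
    · rw [Finset.sum_insert hi, Finset.sum_insert hi]
      abel
    · rw [Finset.prod_insert hi, mul_smul]

variable [LieAlgebra.IsKilling F L]

/-- By the Leibniz formula, `det u * det v` is up to a nonzero factor the determinant of the matrix
of the values of the Killing form. -/
theorem det_mul_det_smul_mem_detValues (hρ : IsGeneralizedAction ρ) (hG : G ∈ detValues ρ b s)
    (u v : ι → Ω → L) :
    (fun ω => (b.det (fun i => u i ω) * b.det fun i => v i ω) • G ω) ∈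
      detValues ρ b (∑ i, {u i} + ∑ i, {v i} + s) := by
  let D := (LinearMap.toMatrix₂ b b (killingForm F L)).det
  have hD : D ≠ 0 := (LinearMap.nondegenerate_iff_det_ne_zero b).1
    (LieAlgebra.IsKilling.killingForm_nondegenerate F L)
  have : (fun ω => (b.det (fun i => u i ω) * b.det fun i => v i ω) • G ω) =
      D⁻¹ • ∑ σ : Equiv.Perm ι, ((Equiv.Perm.sign σ : ℤ) : F) •
        fun ω => (∏ i, killingForm F L (u (σ i) ω) (v i ω)) • G ω := by
    funext ω
    have det_eq := det_of_bilinear b (killingForm F L) (fun i => u i ω) fun i => v i ω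
    rw [Matrix.det_apply'] at det_eq
    simp only [Matrix.of_apply] at det_eq
    simp only [Pi.smul_apply, Finset.sum_apply, smul_smul, ← Finset.sum_smul]
    rw [det_eq, inv_mul_cancel_left₀ hD]
  rw [this]
  refine Submodule.smul_mem _ _ (sum_mem fun σ _ => Submodule.smul_mem _ _ ?_)
  rw [← Equiv.sum_comp σ fun i => ({u i} : Multiset (Ω → L))]
  exact prod_killingForm_smul_mem_detValues hρ hG (fun i => u (σ i)) v Finset.univ

theorem prod_det_smul_mem_detValues (hρ : IsGeneralizedAction ρ) (hG : G ∈ detValues ρ b s)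
    (u v : κ → ι → Ω → L) (A : Finset κ) :
    (fun ω => (∏ k ∈ A, b.det (fun i => u k i ω) * b.det fun i => v k i ω) • G ω) ∈
      detValues ρ b (∑ k ∈ A, (∑ i, {u k i} + ∑ i, {v k i}) + s) := by
  classical
  induction A using Finset.induction_on with
  | empty => simpa using hG
  | insert k A hk ih =>
    convert det_mul_det_smul_mem_detValues hρ ih (u k) (v k) using 2
    · rw [Finset.sum_insert hk]
      abel
    · rw [Finset.prod_insert hk, mul_smul]

end detValues

theorem exists_equiv_fin_prod_bool {C : Type*} [Fintype C] (hC : Even (Fintype.card C)) :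
    ∃ N : ℕ, Nonempty (C ≃ Fin N × Bool) := by
  obtain ⟨N, hN⟩ := hC
  exact ⟨N, ⟨Fintype.equivOfCardEq (by simp [hN, mul_two])⟩⟩

theorem exists_prod_det_smul_mem_polyFunctions [LieAlgebra.IsKilling F L] [FiniteDimensional F L]
    {ρ : H →ₐ[F] Module.End F L} (hρ : IsGeneralizedAction ρ) (hs : IsHSimple ρ)
    (hc : IsHCentral ρ) {d : ℕ} (b : Module.Basis (Fin d) F L) :
    ∃ q : ℕ, ∀ n ≥ q, ∀ (C : Type) [Fintype C], Even (Fintype.card C) →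
      ∃ c : Multiset L, c.card = n ∧ ∃ g : L, g ≠ 0 ∧
        (fun x : C × Fin d → L => (∏ j, b.det fun i => x (j, i)) • g) ∈
          polyFunctions ρ (C × Fin d) c := by
  obtain ⟨q, hq⟩ := exists_det_smul_mem_polyFunctions hρ hs hc (LieAlgebra.center_eq_bot F L) b
  refine ⟨d + q, fun n hn C _ hC => ?_⟩
  obtain ⟨c, hcard, g, hg, h⟩ := hq (n - d) (by omega)
  obtain ⟨N, ⟨e⟩⟩ := exists_equiv_fin_prod_bool hC
  refine ⟨∑ i, {b i} + c, by simp [hcard]; omega, g, hg, ?_⟩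
  have hG : (fun _ => g) ∈ detValues ρ b (c.map (Function.const (C × Fin d → L))) :=
    mem_detValues.2 fun a => polyFunctions_apply_mem_multilinearValues h a
  have hprod := mem_detValues.1 (prod_det_smul_mem_detValues hρ hG
    (fun k i x => x (e.symm (k, true), i)) (fun k i x => x (e.symm (k, false), i)) Finset.univ)
    fun i _ => b i
  rw [polyFunctions]
  convert hprod using 2
  · rw [Multiset.map_add, ← Multiset.coe_mapAddMonoidHom, map_sum, Fintype.sum_prod_type,
      ← e.symm.sum_comp, Fintype.sum_prod_type]
    simp only [Fintype.sum_bool, Multiset.coe_mapAddMonoidHom, Multiset.map_singleton]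
    exact add_left_comm _ _ _
  · rw [← e.symm.prod_comp, Fintype.prod_prod_type, b.det_self, one_smul]
    simp only [Fintype.prod_bool]

/-! ### Balanced words -/

/-- The words with the positions `Fin d × J` in the alphabet `Fin d` in which all letters occur
equally often. -/
def balancedWords (d : ℕ) (J : Type*) : Set (Fin d × J → Fin d) :=
  {w | ∃ e : Equiv.Perm (Fin d × J), w ∘ e = Prod.fst}

section balancedWords

variable {d : ℕ} {J : Type*}

/-- The position of the occurrence number `j` of the letter `r`, as a function of `(r, j)`. -/
def occurrence (w : balancedWords d J) : Equiv.Perm (Fin d × J) := w.2.choose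

theorem apply_occurrence (w : balancedWords d J) (p : Fin d × J) : w.1 (occurrence w p) = p.1 :=
  congrFun w.2.choose_spec p

instance : Nonempty (balancedWords d J) := ⟨⟨Prod.fst, Equiv.refl _, rfl⟩⟩

theorem balancedWords_eq_of_le [Finite J] {w w' : balancedWords d J}
    (h : ∀ p, w.1 p ≤ w'.1 p) : w = w' := by
  have := Fintype.ofFinite J
  have sum_eq (v : balancedWords d J) : ∑ p, (v.1 p : ℕ) = ∑ p : Fin d × J, (p.1 : ℕ) := by
    rw [← Equiv.sum_comp (occurrence v)]
    simp only [apply_occurrence]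
  have := (Finset.sum_eq_sum_iff_of_le (s := Finset.univ) (f := fun p => (w.1 p : ℕ))
    (g := fun p => (w'.1 p : ℕ)) fun p _ => h p).1 ((sum_eq w).trans (sum_eq w').symm)
  exact Subtype.ext (funext fun p => Fin.ext (this p (Finset.mem_univ p)))

/-- Since the rows of `u` have the same content, they may be replaced with one row, and the
cyclic shifts of each of its letters run over the alphabet. -/
theorem shift_mem_balancedWords [NeZero d] [Fintype J] {u : Fin d → J → Fin d}
    {content : Multiset (Fin d)} (hu : ∀ a, ∑ j, {u a j} = content) :
    (fun p => u p.1 p.2 + p.1) ∈ balancedWords d J := by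
  have row_eq (a : Fin d) :
      ∑ j, ({u a j + a} : Multiset (Fin d)) = ∑ j, {u 0 j + a} := by
    have := congrArg (Multiset.mapAddMonoidHom (· + a)) ((hu a).trans (hu 0).symm)
    simpa using this
  have sum_eq : ∑ p : Fin d × J, ({p.1} : Multiset (Fin d)) =
      ∑ p : Fin d × J, {u p.1 p.2 + p.1} := by
    simp only [Fintype.sum_prod_type, row_eq]
    rw [Finset.sum_comm, Finset.sum_comm (f := fun a j => ({u 0 j + a} : Multiset (Fin d)))]
    exact Finset.sum_congr rfl fun j _ =>
      (Equiv.sum_comp (Equiv.addLeft (u 0 j)) fun a => ({a} : Multiset (Fin d))).symm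
  obtain ⟨e, he⟩ := exists_equiv_of_sum_singleton_eq sum_eq
  exact ⟨e, funext he⟩

theorem exists_content_card_ge (d : ℕ) [NeZero d] (J : Type*) [Fintype J] :
    ∃ content : Multiset (Fin d), (d ^ Fintype.card J / (Fintype.card J + 1) ^ d : ℝ) ≤
      Nat.card {u : J → Fin d // ∑ j, {u j} = content} := by
  classical
  let counts (u : J → Fin d) (r : Fin d) : Fin (Fintype.card J + 1) :=
    ⟨(∑ j, ({u j} : Multiset (Fin d))).count r, Nat.lt_succ_of_le
      ((Multiset.count_le_card _ _).trans_eq (by simp))⟩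
  have counts_eq {u v : J → Fin d} (h : counts u = counts v) :
      ∑ j, ({u j} : Multiset (Fin d)) = ∑ j, {v j} :=
    Multiset.ext.2 fun r => congrArg Fin.val (congrFun h r)
  obtain ⟨y, hy⟩ := Fintype.exists_le_card_fiber_of_nsmul_le_card counts
    (b := (d ^ Fintype.card J / (Fintype.card J + 1) ^ d : ℝ))
    (by simp [field])
  obtain ⟨u₀, hu₀⟩ : ∃ u, counts u = y := by
    have : 0 < (d ^ Fintype.card J / (Fintype.card J + 1) ^ d : ℝ) := by
      have := NeZero.pos d
      positivity
    obtain ⟨u, hu⟩ := Finset.card_pos.1 (Nat.cast_pos.1 (this.trans_le hy))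
    exact ⟨u, (Finset.mem_filter.1 hu).2⟩
  refine ⟨∑ j, {u₀ j}, hy.trans ?_⟩
  rw [Nat.card_eq_fintype_card, Fintype.card_subtype, Nat.cast_le]
  exact Finset.card_le_card fun u hu => by
    simpa using counts_eq ((Finset.mem_filter.1 hu).2.trans hu₀.symm)

theorem pow_le_card_balancedWords (d : ℕ) [NeZero d] (J : Type*) [Fintype J] :
    (d ^ Fintype.card J / (Fintype.card J + 1) ^ d : ℝ) ^ d ≤ Nat.card (balancedWords d J) := by
  obtain ⟨content, h⟩ := exists_content_card_ge d J
  let shift (u : Fin d → {u : J → Fin d // ∑ j, {u j} = content}) : balancedWords d J :=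
    ⟨fun p => (u p.1).1 p.2 + p.1, shift_mem_balancedWords fun a => (u a).2⟩
  have shift_injective : Function.Injective shift := fun u v huv =>
    funext fun a => Subtype.ext <| funext fun j =>
      add_right_cancel (congrFun (congrArg Subtype.val huv) (a, j))
  calc (d ^ Fintype.card J / (Fintype.card J + 1) ^ d : ℝ) ^ d
      ≤ Nat.card {u : J → Fin d // ∑ j, {u j} = content} ^ d := by gcongr
    _ ≤ Nat.card (balancedWords d J) := by
      have := Nat.card_le_card_of_injective shift shift_injective
      rw [Nat.card_fun, Nat.card_fin] at this
      exact_mod_cast this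

theorem exists_even_pow_le_card_balancedWords {d : ℕ} {a : ℝ} (ha : 0 < a) (had : a < d) :
    ∃ N > 0, Even N ∧ a ^ (d * N) ≤ Nat.card (balancedWords d (Fin N)) := by
  have : NeZero d := ⟨by rintro rfl; exact had.not_ge (by simpa using ha.le)⟩
  have hda : 1 < d / a := (one_lt_div ha).2 had
  have tendsto_div : Tendsto (fun n : ℕ => ((n + 1 : ℕ) : ℝ) ^ d / (d / a) ^ (n + 1)) atTop (𝓝 0) :=
    (tendsto_pow_const_div_const_pow_of_one_lt d hda).comp (tendsto_add_atTop_nat 1)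
  obtain ⟨M, hM⟩ := eventually_atTop.1
    (tendsto_div.eventually_lt_const (show 0 < (d / a)⁻¹ by positivity))
  let N := 2 * (M + 1)
  have hN : (N + 1 : ℝ) ^ d * a ^ N ≤ d ^ N := by
    have := hM N (by omega)
    rw [div_lt_iff₀ (by positivity), pow_succ', inv_mul_cancel_left₀ (by positivity), div_pow,
      lt_div_iff₀ (by positivity)] at this
    exact_mod_cast this.le
  refine ⟨N, by omega, even_two_mul _, ?_⟩
  calc a ^ (d * N) = (a ^ N) ^ d := by rw [← pow_mul, mul_comm]
    _ ≤ (d ^ N / (N + 1) ^ d) ^ d := by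
      gcongr
      rwa [le_div_iff₀' (by positivity)]
    _ ≤ Nat.card (balancedWords d (Fin N)) := by simpa using pow_le_card_balancedWords d (Fin N)

end balancedWords

/-! ### Columns -/

section columns

variable {d m : ℕ} [NeZero m] {J : Type*}

/-- The cyclic shift by `r` on the set of `m` blocks. -/
def blockShift (m : ℕ) [NeZero m] (r : ℕ) : Equiv.Perm (Fin m) := Equiv.addRight (Fin.ofNat m r)

theorem val_blockShift {r : ℕ} {k : Fin m} (h : k + r < m) : (blockShift m r k : ℕ) = k + r := by
  simp [blockShift, Fin.val_add, Nat.mod_eq_of_lt h]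

/-- The letter of a sequence of `m` words at a position in one of them. -/
def letter (w : Fin m → balancedWords d J) (p : Fin m × (Fin d × J)) : Fin d := (w p.1).1 p.2

/-- The partition of the positions in `m` balanced words into columns: the column `(k, j)` consists
of the occurrences number `j` of the letters `r` in the words number `k + r`, for `r < d`. -/
def columnEquiv (w : Fin m → balancedWords d J) :
    (Fin m × J) × Fin d ≃ Fin m × (Fin d × J) where
  toFun p := (blockShift m p.2 p.1.1, occurrence (w (blockShift m p.2 p.1.1)) (p.2, p.1.2))
  invFun q := (((blockShift m ((occurrence (w q.1)).symm q.2).1).symm q.1,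
    ((occurrence (w q.1)).symm q.2).2), ((occurrence (w q.1)).symm q.2).1)
  left_inv p := by simp
  right_inv q := by simp

theorem letter_columnEquiv_self (w : Fin m → balancedWords d J) (c : Fin m × J) (r : Fin d) :
    letter w (columnEquiv w (c, r)) = r :=
  apply_occurrence _ _

theorem letter_columnEquiv_congr {w w' : Fin m → balancedWords d J} {c : Fin m × J} {r : Fin d}
    (h : w (blockShift m r c.1) = w' (blockShift m r c.1)) :
    letter w' (columnEquiv w (c, r)) = r := by
  rw [letter, columnEquiv, Equiv.coe_fn_mk, ← h, apply_occurrence]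

/-- The block number `k` of `w'` has at least the letter `r` where that of `w` has `r`, because the
smaller letters are already taken, in the same column, by the preceding blocks. -/
theorem eq_of_columns_injective [Finite J] {w w' : Fin m → balancedWords d J}
    (h₀ : ∀ k : Fin m, k < d → w k = w' k)
    (h : ∀ c, Function.Injective fun r => letter w' (columnEquiv w (c, r))) : w = w' := by
  suffices ∀ n, ∀ k : Fin m, (k : ℕ) = n → w k = w' k from funext fun k => this _ k rfl
  intro n
  induction n using Nat.strong_induction_on with
  | _ n ih =>
    rintro k rfl
    rcases Nat.lt_or_ge k d with hk | hk
    · exact h₀ k hk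
    refine balancedWords_eq_of_le fun p => ?_
    obtain ⟨⟨r, j⟩, rfl⟩ := (occurrence (w k)).surjective p
    rw [apply_occurrence]
    let k₀ : Fin m := ⟨k - r, by omega⟩
    have val_shift {r' : Fin d} (hr' : r' ≤ r) : (blockShift m r' k₀ : ℕ) = k - r + r' :=
      val_blockShift (by simp only [k₀]; omega)
    have letter_of_lt {r' : Fin d} (hr' : r' < r) :
        letter w' (columnEquiv w ((k₀, j), r')) = r' :=
      letter_columnEquiv_congr (ih _ (by rw [val_shift hr'.le]; omega) _ rfl)
    have shift_eq : blockShift m r k₀ = k := Fin.ext (by rw [val_shift le_rfl]; omega)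
    have letter_eq :
        letter w' (columnEquiv w ((k₀, j), r)) = (w' k).1 (occurrence (w k) (r, j)) := by
      simp only [letter, columnEquiv, Equiv.coe_fn_mk, shift_eq]
    by_contra! hlt
    exact hlt.ne (h (k₀, j) ((letter_of_lt hlt).trans letter_eq.symm))

theorem prod_det_columns [Fintype J] {V : Type*} [AddCommGroup V] [Module F V]
    (b : Module.Basis (Fin d) F V) {w w' : Fin m → balancedWords d J}
    (h₀ : ∀ k : Fin m, k < d → w k = w' k) [Decidable (w = w')] :
    ∏ c, b.det (fun r => b (letter w' (columnEquiv w (c, r)))) = if w = w' then 1 else 0 := by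
  split_ifs with hw
  · subst hw
    simp only [letter_columnEquiv_self, Finset.prod_eq_one, b.det_self, implies_true]
  · obtain ⟨c, hc⟩ : ∃ c, ¬ Function.Injective fun r => letter w' (columnEquiv w (c, r)) := by
      contrapose! hw
      exact eq_of_columns_injective h₀ hw
    refine Finset.prod_eq_zero (Finset.mem_univ c) ?_
    exact b.det.map_eq_zero_of_not_injective _ fun h => hc fun r r' hr => h (congrArg b hr)

end columns

/-! ### The lower bound -/

theorem card_le_codim_of_single_mem [FiniteDimensional F L] [Finite Ω] [DecidableEq Ω]
    {ρ : H →ₐ[F] Module.End F L} {s : Multiset (Ω → L)} {g : L} (hg : g ≠ 0)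
    (h : ∀ ω, Pi.single ω g ∈ multilinearValues (piAction ρ Ω) s) :
    Nat.card Ω ≤ codim ρ s.card := by
  have := Fintype.ofFinite Ω
  have single_independent : LinearIndependent F fun ω : Ω =>
      (⟨Pi.single ω g, h ω⟩ : multilinearValues (piAction ρ Ω) s) :=
    .of_comp (Submodule.subtype _) (Pi.linearIndependent_single_of_ne_zero fun _ => hg)
  calc Nat.card Ω = Fintype.card Ω := Nat.card_eq_fintype_card
    _ ≤ Module.finrank F (multilinearValues (piAction ρ Ω) s) :=
      single_independent.fintype_card_le_finrank
    _ ≤ codim ρ s.card := finrank_multilinearValues_le_codim ρ s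

theorem card_balancedWords_pow_le_codim [LieAlgebra.IsKilling F L] [FiniteDimensional F L]
    {ρ : H →ₐ[F] Module.End F L} (hρ : IsGeneralizedAction ρ) (hs : IsHSimple ρ)
    (hc : IsHCentral ρ) {d : ℕ} [NeZero d] (b : Module.Basis (Fin d) F L) :
    ∃ q : ℕ, ∀ N K n : ℕ, Even N → (d + K) * (d * N) + q ≤ n →
      Nat.card (balancedWords d (Fin N)) ^ K ≤ codim ρ n := by
  classical
  obtain ⟨q, hq⟩ := exists_prod_det_smul_mem_polyFunctions hρ hs hc b
  refine ⟨q, fun N K n hN hn => ?_⟩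
  obtain ⟨c, hcard, g, hg, hmem⟩ := hq (n - (d + K) * (d * N)) (by omega)
    (Fin (d + K) × Fin N) (by simpa using hN.mul_left _)
  have : NeZero (d + K) := ⟨by have := NeZero.ne d; omega⟩
  obtain ⟨w₀⟩ : Nonempty (balancedWords d (Fin N)) := inferInstance
  -- The first `d` blocks are fixed: a column only tests a block against the preceding ones.
  let blocks (w : Fin K → balancedWords d (Fin N)) : Fin (d + K) → balancedWords d (Fin N) :=
    Fin.append (fun _ => w₀) w
  have blocks_injective : Function.Injective blocks := fun w w' h => funext fun k => by
    simpa [blocks] using congrFun h (Fin.natAdd d k)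
  have blocks_eq (w w') (k : Fin (d + K)) (hk : k < d) : blocks w k = blocks w' k := by
    obtain ⟨k, rfl⟩ : ∃ i : Fin d, k = Fin.castAdd K i := ⟨⟨k, hk⟩, rfl⟩
    simp [blocks]
  let x (p : Fin (d + K) × (Fin d × Fin N)) (w : Fin K → balancedWords d (Fin N)) : L :=
    b (letter (blocks w) p)
  have single_mem (w : Fin K → balancedWords d (Fin N)) : Pi.single w g ∈
      multilinearValues (piAction ρ _) (∑ p, {x p} + c.map (Function.const _)) := by
    have := polyFunctions_apply_mem_multilinearValues hmem fun p => x (columnEquiv (blocks w) p)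
    rw [Equiv.sum_comp (columnEquiv (blocks w)) fun p => ({x p} : Multiset (_ → L))] at this
    convert this using 1
    funext w'
    rw [prod_det_columns b (blocks_eq w w'), Pi.single_apply]
    simp [blocks_injective.eq_iff, eq_comm]
  calc Nat.card (balancedWords d (Fin N)) ^ K
      = Nat.card (Fin K → balancedWords d (Fin N)) := by simp
    _ ≤ codim ρ (∑ p, {x p} + c.map (Function.const _)).card :=
      card_le_codim_of_single_mem hg single_mem
    _ = codim ρ n := by
      congr 1
      simp [hcard]
      omega

/-! ### Exponential growth -/

theorem exists_mul_pow_le_of_pow_le {c : ℕ → ℝ} {a : ℝ} (ha : 0 < a) {D q : ℕ} (hD : 0 < D)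
    (h : ∀ K n, K * D + q ≤ n → (a ^ D) ^ K ≤ c n) :
    ∃ C > 0, ∀ᶠ n in atTop, C * a ^ n ≤ c n := by
  let A := max a 1 ^ (D + q)
  have hA : 0 < A := by positivity
  refine ⟨A⁻¹, inv_pos.2 hA, ?_⟩
  filter_upwards [eventually_ge_atTop q] with n hn
  obtain ⟨t, rfl⟩ := Nat.exists_eq_add_of_le hn
  have pow_rest_le : a ^ (t % D + q) ≤ A :=
    calc a ^ (t % D + q) ≤ max a 1 ^ (t % D + q) := by gcongr; exact le_max_left a 1
      _ ≤ A := pow_le_pow_right₀ (le_max_right a 1) (by grind [Nat.mod_lt t hD])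
  calc A⁻¹ * a ^ (q + t) = (a ^ D) ^ (t / D) * (A⁻¹ * a ^ (t % D + q)) := by
        conv_lhs => rw [← Nat.div_add_mod t D]
        ring
    _ ≤ (a ^ D) ^ (t / D) := mul_le_of_le_one_right (by positivity)
        ((inv_mul_le_one₀ hA).2 pow_rest_le)
    _ ≤ c (q + t) := h _ _ (by have := Nat.div_mul_le_self t D; omega)

theorem tendsto_const_mul_pow_rpow_one_div {C a : ℝ} (hC : 0 < C) (ha : 0 ≤ a) :
    Tendsto (fun n : ℕ => (C * a ^ n) ^ (1 / (n : ℝ))) atTop (𝓝 a) := by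
  have tendsto_root : Tendsto (fun n : ℕ => C ^ (1 / (n : ℝ)) * a) atTop (𝓝 a) := by
    simpa using
      (tendsto_const_nhds.rpow tendsto_one_div_atTop_nhds_zero_nat (Or.inl hC.ne')).mul_const a
  refine tendsto_root.congr' ?_
  filter_upwards [eventually_ne_atTop 0] with n hn
  rw [Real.mul_rpow hC.le (by positivity), one_div, Real.pow_rpow_inv_natCast ha hn]

theorem tendsto_rpow_one_div_of_pow_bounds {c : ℕ → ℝ} {d C : ℝ} (hd : 0 < d) (hC : 0 < C)
    (hc : ∀ n, 0 ≤ c n) (upper : ∀ n, c n ≤ C * d ^ n)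
    (lower : ∀ a, 0 < a → a < d → ∃ C > 0, ∀ᶠ n in atTop, C * a ^ n ≤ c n) :
    Tendsto (fun n : ℕ => c n ^ (1 / (n : ℝ))) atTop (𝓝 d) := by
  refine tendsto_order.2 ⟨fun a had => ?_, fun a hda => ?_⟩
  · obtain ⟨a', ha', ha'd⟩ := exists_between (max_lt had hd)
    obtain ⟨haa', ha'0⟩ := max_lt_iff.1 ha'
    obtain ⟨C', hC', hlower⟩ := lower a' ha'0 ha'd
    filter_upwards [hlower, (tendsto_const_mul_pow_rpow_one_div hC' ha'0.le).eventually_const_lt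
      haa'] with n hn han
    exact han.trans_le (by gcongr)
  · filter_upwards [(tendsto_const_mul_pow_rpow_one_div hC hd.le).eventually_lt_const hda]
      with n hn
    exact hn.trans_le' (Real.rpow_le_rpow (hc n) (upper n) (by positivity))

theorem exists_mul_pow_le_codim [LieAlgebra.IsKilling F L] [FiniteDimensional F L]
    {ρ : H →ₐ[F] Module.End F L} (hρ : IsGeneralizedAction ρ) (hs : IsHSimple ρ)
    (hc : IsHCentral ρ) {a : ℝ} (ha : 0 < a) (had : a < Module.finrank F L) :
    ∃ C > 0, ∀ᶠ n in atTop, C * a ^ n ≤ codim ρ n := by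
  have := nontrivial_of_not_isLieAbelian hs.1
  have : NeZero (Module.finrank F L) := ⟨Module.finrank_pos.ne'⟩
  obtain ⟨q, hq⟩ := card_balancedWords_pow_le_codim hρ hs hc (Module.finBasis F L)
  obtain ⟨N, hN₀, hN, hcard⟩ := exists_even_pow_le_card_balancedWords ha had
  set d := Module.finrank F L
  refine exists_mul_pow_le_of_pow_le ha (D := d * N) (q := d * (d * N) + q)
    (Nat.mul_pos (NeZero.pos d) hN₀) fun K n hn => ?_
  calc (a ^ (d * N)) ^ K ≤ (Nat.card (balancedWords d (Fin N)) : ℝ) ^ K := by gcongr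
    _ ≤ codim ρ n := by exact_mod_cast hq N K n hN (by rw [add_mul]; omega)

end HLie

end

theorem mainTheorem2_general {F H L : Type*} [Field F] [Ring H] [Algebra F H]
    [LieRing L] [LieAlgebra F L] [FiniteDimensional F L] [LieAlgebra.IsKilling F L]
    (ρ : H →ₐ[F] Module.End F L) (hρ : HLie.IsGeneralizedAction ρ) (hc : HLie.IsHCentral ρ)
    (hsimple : HLie.IsHSimple ρ) :
    (∀ n : ℕ, HLie.codim ρ n ≤ Module.finrank F L ^ (n + 1)) ∧
      HLie.HasHExponent ρ (Module.finrank F L : ℝ) := by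
  have := HLie.nontrivial_of_not_isLieAbelian hsimple.1
  have finrank_pos : (0 : ℝ) < Module.finrank F L := Nat.cast_pos.2 Module.finrank_pos
  refine ⟨HLie.codim_le ρ, HLie.tendsto_rpow_one_div_of_pow_bounds finrank_pos finrank_pos
    (fun n => Nat.cast_nonneg _) (fun n => ?_)
    fun a => HLie.exists_mul_pow_le_codim hρ hsimple hc⟩
  rw [← pow_succ']
  exact_mod_cast HLie.codim_le ρ n

theorem mainTheorem2 {F H L : Type*} [Field F] [CharZero F]
    [Ring H] [Algebra F H] [FiniteDimensional F H]
    [LieRing L] [LieAlgebra F L] [FiniteDimensional F L]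
    (ρ : H →ₐ[F] Module.End F L) (hρ : HLie.IsGeneralizedAction ρ)
    (hF : IsAlgClosed F ∨ HLie.IsHCentral ρ)
    (hsimple : HLie.IsHSimple ρ) (hss : LieAlgebra.IsSemisimple F L) :
    (∀ n : ℕ, HLie.codim ρ n ≤ Module.finrank F L ^ (n + 1)) ∧
      HLie.HasHExponent ρ (Module.finrank F L : ℝ) :=
  mainTheorem2_general ρ hρ (hF.elim (fun _ => hsimple.isHCentral) id) hsimple
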